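/- Theorem (optimistic policy iteration for acyclic stochastic shortest path problems). Consider a Markov decision process with finite state space $\{0,1,\dots,n\}$, a finite nonempty set $A(i)$ of actions at each state $i$, transition probabilities $P_{ij}(u)$ and deterministic costs $c(i,u)\ge 0$ for $u\in A(i)$. A policy $\mu$ assigns to each state $i$ an action $\mu(i)\in A(i)$; let $X^\mu=(X^\mu_k)_{k\ge 0}$ be the Markov chain with transition probabilities $P_{ij}(\mu(i))$ and a fixed initial distribution $p$. Assume: (1) for every policy $\mu$ and every state $i$, $\mathbb P(X^\mu_k=i\text{ for some }k\ge 0)>0$; (2) for all states $i,j$ and all $u,v\in A(i)$, $P_{ij}(u)>0$ if and only if $P_{ij}(v)>0$; (3) $0$ is the unique absorbing state ($P_{00}(u)=1$ for all $u\in A(0)$), $c(0,u)=0$ for all $u\in A(0)$, and the directed graph on $\{1,\dots,n\}$ with an edge $(i,j)$ whenever $P_{ij}(u)>0$ for some $u\in A(i)$ has no directed cycle (loops count as cycles). Let $J^\mu(i)=\mathbb E\big[\sum_{k\ge 0}c(X^\mu_k,\mu(X^\mu_k))\,\big|\,X^\mu_0=i\big]$ and $J^*(i)=\min_\mu J^\mu(i)$.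 Let $\beta:\mathbb N\to[0,\infty)$ satisfy $\sum_t\beta(t)=\infty$ and $\sum_t\beta(t)^2<\infty$. Define random vectors $J_t\in\mathbb R^{n+1}$ as follows. Start with $J_0=0$. At iteration $t=0,1,2,\dots$ choose, on the basis of the past, a greedy policy $\mu_t$, that is, for every state $i$ the action $\mu_t(i)$ minimizes $c(i,u)+\sum_j P_{ij}(u)J_t(j)$ over $u\in A(i)$ (ties are broken arbitrarily). Then sample a trajectory $X^{(t)}=(X^{(t)}_k)_{k\ge 0}$ which, conditionally on the past, is a Markov chain with initial distribution $p$ and transition probabilities $P_{ij}(\mu_t(i))$. For every state $i$ visited by $X^{(t)}$, with first visit at time $N_t(i)$, put $$J_{t+1}(i)=(1-\gamma_t(i))J_t(i)+\gamma_t(i)\sum_{k=N_t(i)}^\infty c\big(X^{(t)}_k,\mu_t(X^{(t)}_k)\big),$$ and put $J_{t+1}(i)=J_t(i)$ for all other states $i$. The step sizes are either $\gamma_t(i)=\beta(t)$ for all $t,i$; or $\gamma_t(i)=\beta(n_t(i))$ for all $t,i$, where $n_t(i)$ is the number of $s<t$ such that $X^{(s)}$ visits $i$, and in this second case $\beta$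 is also assumed to be nonincreasing from some point on. Then, for either choice of the step sizes, $J_t\to J^*$ almost surely as $t\to\infty$. -/

import Mathlib

open MeasureTheory ProbabilityTheory Filter Topology

universe u v w

/-- A Markov decision process with state space `S`, a finite nonempty set of actions at each
state, transition probabilities `P i u j = P_{ij}(u)` and nonnegative deterministic costs
`c i u`. -/
structure FiniteMDP (S : Type u) where
  /-- the set `A(i)` of actions available at state `i` -/
  Action : S → Type v
  [fintypeAction : ∀ i, Fintype (Action i)]
  [nonemptyAction : ∀ i, Nonempty (Action i)]
  /-- `P i u` is the law of the next state when action `u` is taken at state `i` -/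
  P : (i : S) → Action i → PMF S
  c : (i : S) → Action i → ℝ
  c_nonneg : ∀ i u, 0 ≤ c i u

namespace FiniteMDP

attribute [instance] FiniteMDP.fintypeAction FiniteMDP.nonemptyAction

section Policies

variable {S : Type u} (M : FiniteMDP.{u, v} S)

/-- A (stationary, deterministic) policy. -/
abbrev Policy : Type (max u v) := (i : S) → M.Action i

/-- The edges of the one-step reachability graph. -/
def Edge (i j : S) : Prop := ∃ m : M.Policy, 0 < M.P i (m i) j

/-- The set of one-step successors of a state does not depend on the action. -/
def CommonTransitions : Prop :=
  ∀ (i j : S) (u v : M.Action i), 0 < M.P i u j ↔ 0 < M.P i v j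

/-- State `i` is absorbing: under every action the chain stays at `i`. -/
def Absorbing (i : S) : Prop := ∀ u : M.Action i, M.P i u i = 1

/-- `z` is the unique absorbing state, it is cost free, and the subgraph of the reachability
graph induced by the other states has no directed cycle (loops included). -/
structure IsAcyclicSSP (z : S) : Prop where
  absorbing : M.Absorbing z
  unique : ∀ i, M.Absorbing i → i = z
  cost_zero : ∀ u : M.Action z, M.c z u = 0
  acyclic : ∀ i : {s : S // s ≠ z},
    ¬ Relation.TransGen (fun a b : {s : S // s ≠ z} => M.Edge a b) i i

/-- The undiscounted Bellman backup of `J` at state `i` for the action `a`. -/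
noncomputable def backup [Fintype S] (J : S → ℝ) (i : S) (a : M.Action i) : ℝ :=
  M.c i a + ∑ j, (M.P i a j).toReal * J j

/-- `m` is a greedy policy with respect to `J`, that is, `m ∈ argmin_m T_m J`
(the minimum is componentwise; ties may be broken in any way). -/
def IsGreedy [Fintype S] (J : S → ℝ) (m : M.Policy) : Prop :=
  ∀ i, ∀ a : M.Action i, M.backup J i (m i) ≤ M.backup J i a

end Policies

section Chain

variable {S : Type u} [Fintype S] [MeasurableSpace S] [MeasurableSingletonClass S]
  (M : FiniteMDP.{u, v} S)

/-- The one-step transition kernel of the chain `X^m`. -/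
noncomputable def stepKernel (m : M.Policy) : Kernel S S :=
  Kernel.ofFunOfCountable fun i => (M.P i (m i)).toMeasure

instance (m : M.Policy) : IsMarkovKernel (M.stepKernel m) :=
  ⟨fun i => by
    change IsProbabilityMeasure ((M.P i (m i)).toMeasure)
    infer_instance⟩

/-- The transition kernel at time `k`, as a function of the whole history up to time `k`;
it depends on the state at time `k` only. -/
noncomputable def historyKernel (m : M.Policy) (k : ℕ) :
    Kernel ((i : Finset.Iic k) → (fun _ : ℕ => S) i) S :=
  (M.stepKernel m).comap (fun h => h ⟨k, Finset.mem_Iic.2 le_rfl⟩) (measurable_pi_apply _)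

instance (m : M.Policy) (k : ℕ) : IsMarkovKernel (M.historyKernel m k) := by
  unfold historyKernel
  infer_instance

/-- The law, on the space of trajectories, of the Markov chain `X^m` with initial
distribution `p` that follows the policy `m`. -/
noncomputable def trajLaw (p : PMF S) (m : M.Policy) : Measure (ℕ → S) :=
  Kernel.trajMeasure (X := fun _ => S) p.toMeasure (M.historyKernel m)

/-- `q_m(i)`, the probability that the chain ever reaches the state `i`. -/
noncomputable def reachProb (p : PMF S) (m : M.Policy) (i : S) : ENNReal :=
  M.trajLaw p m {x | ∃ k, x k = i}

/-- Every state is reached with positive probability under every policy. -/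
def PositiveReachability (p : PMF S) : Prop :=
  ∀ (m : M.Policy) (i : S), 0 < M.reachProb p m i

/-- `J^m(i)`, the expected cumulative undiscounted cost of the policy `m` from state `i`. -/
noncomputable def costToGo (m : M.Policy) (i : S) : ℝ :=
  ∫ x, ∑' k, M.c (x k) (m (x k)) ∂(M.trajLaw (PMF.pure i) m)

/-- `J^*(i) = min_m J^m(i)`, a minimum over the finitely many policies. -/
noncomputable def optimalCost (i : S) : ℝ := ⨅ m : M.Policy, M.costToGo m i

end Chain

section Algorithm

variable {S : Type u} (M : FiniteMDP.{u, v} S)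

/-- State `i` is visited by the trajectory `x`. -/
def Visits (x : ℕ → S) (i : S) : Prop := ∃ k, x k = i

/-- The first time at which `x` visits `i` (used only when `x` visits `i`). -/
noncomputable def hitTime (x : ℕ → S) (i : S) : ℕ := sInf {k | x k = i}

/-- The cost that the trajectory `x` accumulates under the policy `m` from its first visit
to `i` onwards. -/
noncomputable def tailCost (m : M.Policy) (x : ℕ → S) (i : S) : ℝ :=
  ∑' k, M.c (x (hitTime x i + k)) (m (x (hitTime x i + k)))

open Classical in
/-- The number of trajectories among the first `t` ones that visit `i`. -/
noncomputable def visitCount (x : ℕ → ℕ → S) (t : ℕ) (i : S) : ℕ :=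
  ((Finset.range t).filter fun s => Visits (x s) i).card

open Classical in
/-- One update of the value vector `J`, in all the states visited by the trajectory `x` of the
policy `m`, with step sizes `γ`. -/
noncomputable def update (γ : S → ℝ) (m : M.Policy) (x : ℕ → S) (J : S → ℝ) : S → ℝ :=
  fun i => if Visits x i then (1 - γ i) * J i + γ i * M.tailCost m x i else J i

/-- A run of optimistic policy iteration with step sizes `γ t ω i = γ_t(i)` on a filtered
probability space. `J t` is the value vector, `pol t` the policy and `X t` the trajectory of
iteration `t`; the σ-algebra `ℱ t` is the information available before the `t`-th trajectory is
sampled, and given it the trajectory is a Markov chain that starts from `p` and follows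
`pol t`. -/
structure IsOPIRun [Fintype S] [MeasurableSpace S] [MeasurableSingletonClass S] (p : PMF S)
    {Ω : Type w} {mΩ : MeasurableSpace Ω} (ℙ' : Measure Ω) (ℱ : Filtration ℕ mΩ)
    (γ : ℕ → Ω → S → ℝ) (J : ℕ → Ω → S → ℝ) (pol : ℕ → Ω → M.Policy)
    (X : ℕ → Ω → ℕ → S) : Prop where
  init : ∀ ω, J 0 ω = 0
  greedy : ∀ t ω, M.IsGreedy (J t ω) (pol t ω)
  step : ∀ t ω, J (t + 1) ω = M.update (γ t ω) (pol t ω) (X t ω) (J t ω)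
  pol_measurable : ∀ t (m : M.Policy), MeasurableSet[ℱ t] {ω | pol t ω = m}
  traj_measurable : ∀ t, Measurable[ℱ (t + 1)] (X t)
  traj_law : ∀ t (B : Set (ℕ → S)), MeasurableSet B →
    ℙ'⟦X t ⁻¹' B | ℱ t⟧ =ᵐ[ℙ'] fun ω => (M.trajLaw p (pol t ω)).real B

end Algorithm

end FiniteMDP

/-!
For a policy `m` write `V` for its cost-to-go. Along a trajectory of `m` the sampled cost from the
first visit to `i` differs from `V i` by a sum of temporal differences
`c (x k) + V (x (k + 1)) - V (x k)`, which have conditional mean zero because `V` solves the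
Bellman equation of `m`. Each component of the value vector thus follows a stochastic
approximation recursion that averages the costs-to-go of the current policies with noise in the
form of square-summable martingale differences. The step sizes along the visits to `i` are not
summable, since the probability of visiting `i` is bounded below over the finitely many policies.
Hence `J t i` converges as soon as the costs-to-go of the greedy policies at `i` do, and to the
same limit.

By acyclicity, the backup at a state other than the absorbing one only involves states of smaller
height. If `J t` is close to the optimal cost at those states, a greedy action at `i` is nearly
optimal, so the costs-to-go of the greedy policies converge to the optimal cost by induction on
the height.
-/

section StochasticApproximation

theorem tendsto_zero_of_summable_sq {a : ℕ → ℝ} (ha : Summable fun t => a t ^ 2) :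
    Tendsto a atTop (𝓝 0) := by
  rw [tendsto_zero_iff_abs_tendsto_zero]
  simpa only [Function.comp_def, Real.sqrt_sq_eq_abs, Real.sqrt_zero] using
    ha.tendsto_atTop_zero.sqrt

theorem tendsto_prod_Ico_one_sub_atTop_zero {a : ℕ → ℝ} {T : ℕ} (ha : ∀ t ≥ T, a t ≤ 1)
    (hsum : Tendsto (fun N => ∑ t ∈ Finset.range N, a t) atTop atTop) :
    Tendsto (fun N => ∏ t ∈ Finset.Ico T N, (1 - a t)) atTop (𝓝 0) := by
  have hexp : Tendsto (fun N => Real.exp (-∑ t ∈ Finset.Ico T N, a t)) atTop (𝓝 0) := by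
    refine Real.tendsto_exp_neg_atTop_nhds_zero.comp ?_
    refine (tendsto_atTop_add_const_right atTop (-∑ t ∈ Finset.range T, a t) hsum).congr' ?_
    filter_upwards [eventually_ge_atTop T] with N hN
    rw [Finset.sum_Ico_eq_sub a hN, sub_eq_add_neg]
  have hnonneg : ∀ N, ∀ t ∈ Finset.Ico T N, 0 ≤ 1 - a t := fun N t ht =>
    sub_nonneg.2 (ha t (Finset.mem_Ico.1 ht).1)
  refine squeeze_zero (fun N => Finset.prod_nonneg (hnonneg N)) (fun N => ?_) hexp
  rw [← Finset.sum_neg_distrib, Real.exp_sum]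
  exact Finset.prod_le_prod (hnonneg N) fun t _ => Real.one_sub_le_exp_neg (a t)

variable {E : Type*} [NormedAddCommGroup E] [NormedSpace ℝ E] {a : ℕ → ℝ}

theorem tendsto_zero_of_averaging {z e : ℕ → E} (ha : ∀ t, 0 ≤ a t)
    (ha_lim : Tendsto a atTop (𝓝 0))
    (hsum : Tendsto (fun N => ∑ t ∈ Finset.range N, a t) atTop atTop)
    (he : Tendsto e atTop (𝓝 0)) (hz : ∀ t, z (t + 1) = (1 - a t) • z t + a t • e t) :
    Tendsto z atTop (𝓝 0) := by
  rw [NormedAddGroup.tendsto_nhds_zero]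
  intro ε hε
  obtain ⟨T, hT⟩ : ∃ T, ∀ t ≥ T, ‖e t‖ < ε / 2 ∧ a t ≤ 1 := eventually_atTop.1
    ((NormedAddGroup.tendsto_nhds_zero.1 he _ (half_pos hε)).and
      (ha_lim.eventually (ge_mem_nhds one_pos)))
  have hcontract : ∀ t ≥ T, ‖z (t + 1)‖ - ε / 2 ≤ (1 - a t) * (‖z t‖ - ε / 2) + 0 := by
    intro t ht
    have hnorm : ‖z (t + 1)‖ ≤ (1 - a t) * ‖z t‖ + a t * ‖e t‖ := by
      rw [hz]
      refine (norm_add_le _ _).trans_eq ?_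
      rw [norm_smul_of_nonneg (sub_nonneg.2 (hT t ht).2), norm_smul_of_nonneg (ha t)]
    linarith [mul_le_mul_of_nonneg_left (hT t ht).1.le (ha t)]
  have hlim := (tendsto_prod_Ico_one_sub_atTop_zero (fun t ht => (hT t ht).2) hsum).const_mul
    (‖z T‖ - ε / 2)
  rw [mul_zero] at hlim
  filter_upwards [eventually_ge_atTop T, hlim.eventually (gt_mem_nhds (half_pos hε))]
    with t ht hsmall
  have hbound := discrete_gronwall_prod_general (u := fun t => ‖z t‖ - ε / 2) (b := fun _ => 0)
    hcontract (fun t ht => sub_nonneg.2 (hT t ht).2) ht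
  simp only [zero_mul, Finset.sum_const_zero, add_zero] at hbound
  linarith

/-- Adding to `y` the tail of the noise series turns the recursion into noiseless averaging. -/
theorem tendsto_of_stochastic_approximation {y e w : ℕ → E} {l : E} (ha : ∀ t, 0 ≤ a t)
    (ha_lim : Tendsto a atTop (𝓝 0))
    (hsum : Tendsto (fun N => ∑ t ∈ Finset.range N, a t) atTop atTop)
    (hw : ∃ W, Tendsto (fun N => ∑ t ∈ Finset.range N, w t) atTop (𝓝 W))
    (he : Tendsto e atTop (𝓝 l))
    (hy : ∀ t, y (t + 1) = (1 - a t) • y t + a t • e t + w t) :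
    Tendsto y atTop (𝓝 l) := by
  obtain ⟨W, hW⟩ := hw
  let tail : ℕ → E := fun N => W - ∑ t ∈ Finset.range N, w t
  have htail : Tendsto tail atTop (𝓝 0) := by simpa [tail] using hW.const_sub W
  have hinput : Tendsto (fun t => e t - l + tail t) atTop (𝓝 0) := by
    simpa using (he.sub_const l).add htail
  have hshifted : Tendsto (fun t => y t - l + tail t) atTop (𝓝 0) := by
    refine tendsto_zero_of_averaging ha ha_lim hsum hinput fun t => ?_
    simp only [tail, hy, Finset.sum_range_succ]
    module
  simpa using (hshifted.sub htail).add_const l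

end StochasticApproximation

section MartingaleDifferences

variable {Ω : Type*} {m mΩ : MeasurableSpace Ω} {μ : Measure Ω}

theorem condExp_mul_eq_zero {g ξ : Ω → ℝ} (hg : StronglyMeasurable[m] g)
    (hgξ : Integrable (fun ω => g ω * ξ ω) μ) (hξ : Integrable ξ μ) (hcond : μ[ξ | m] =ᵐ[μ] 0) :
    μ[fun ω => g ω * ξ ω | m] =ᵐ[μ] 0 := by
  filter_upwards [condExp_mul_of_stronglyMeasurable_left hg hgξ hξ, hcond] with ω hmul hzero
  exact hmul.trans (by simp [hzero])

theorem integral_mul_eq_zero_of_condExp_eq_zero {g ξ : Ω → ℝ} (hm : m ≤ mΩ)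
    [SigmaFinite (μ.trim hm)] (hg : StronglyMeasurable[m] g)
    (hgξ : Integrable (fun ω => g ω * ξ ω) μ) (hξ : Integrable ξ μ) (hcond : μ[ξ | m] =ᵐ[μ] 0) :
    ∫ ω, g ω * ξ ω ∂μ = 0 := by
  rw [← integral_condExp hm]
  exact integral_eq_zero_of_ae (condExp_mul_eq_zero hg hgξ hξ hcond)

variable [IsFiniteMeasure μ] {ℱ : Filtration ℕ mΩ} {ξ : ℕ → Ω → ℝ}

theorem martingale_sum_range (hξ : ∀ t, StronglyMeasurable[ℱ (t + 1)] (ξ t))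
    (hint : ∀ t, Integrable (ξ t) μ) (hcond : ∀ t, μ[ξ t | ℱ t] =ᵐ[μ] 0) :
    Martingale (fun N ω => ∑ t ∈ Finset.range N, ξ t ω) ℱ μ := by
  refine martingale_of_condExp_sub_eq_zero_nat (fun N => ?_)
    (fun N => integrable_finsetSum _ fun t _ => hint t) fun N => ?_
  · exact Finset.stronglyMeasurable_fun_sum _ fun t ht =>
      (hξ t).mono (ℱ.mono (Finset.mem_range.1 ht))
  · have hsub : ((fun ω => ∑ t ∈ Finset.range (N + 1), ξ t ω) -
        fun ω => ∑ t ∈ Finset.range N, ξ t ω) = ξ N := by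
      ext ω
      simp [Finset.sum_range_succ]
    rw [hsub]
    exact hcond N

theorem integral_sq_sum_range (hξ : ∀ t, StronglyMeasurable[ℱ (t + 1)] (ξ t))
    (hL2 : ∀ t, MemLp (ξ t) 2 μ) (hcond : ∀ t, μ[ξ t | ℱ t] =ᵐ[μ] 0) (N : ℕ) :
    ∫ ω, (∑ t ∈ Finset.range N, ξ t ω) ^ 2 ∂μ = ∑ t ∈ Finset.range N, ∫ ω, ξ t ω ^ 2 ∂μ := by
  induction N with
  | zero => simp
  | succ N ih =>
    let s : Ω → ℝ := fun ω => ∑ t ∈ Finset.range N, ξ t ω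
    have hint : ∀ t, Integrable (ξ t) μ := fun t => (hL2 t).integrable one_le_two
    have hs : MemLp s 2 μ := memLp_finsetSum _ fun t _ => hL2 t
    have hsξ : Integrable (fun ω => s ω * ξ N ω) μ := hs.integrable_mul (hL2 N)
    have horth : ∫ ω, s ω * ξ N ω ∂μ = 0 :=
      integral_mul_eq_zero_of_condExp_eq_zero (ℱ.le N)
        ((martingale_sum_range hξ hint hcond).stronglyAdapted N) hsξ (hint N) (hcond N)
    have hexpand : ∀ ω, (∑ t ∈ Finset.range (N + 1), ξ t ω) ^ 2 =
        s ω ^ 2 + 2 * (s ω * ξ N ω) + ξ N ω ^ 2 := fun ω => by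
      rw [Finset.sum_range_succ]
      ring
    have hsum : Integrable (fun ω => s ω ^ 2 + 2 * (s ω * ξ N ω)) μ :=
      hs.integrable_sq.add (hsξ.const_mul 2)
    simp_rw [hexpand]
    rw [integral_add hsum (hL2 N).integrable_sq,
      integral_add hs.integrable_sq (hsξ.const_mul 2), integral_const_mul, horth, ih,
      Finset.sum_range_succ, mul_zero, add_zero]

theorem ae_exists_tendsto_of_integral_sq_le {f : ℕ → Ω → ℝ}
    (hf : Submartingale f ℱ μ) (hL2 : ∀ N, MemLp (f N) 2 μ) {B : ℝ}
    (hB : ∀ N, ∫ ω, f N ω ^ 2 ∂μ ≤ B) :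
    ∀ᵐ ω ∂μ, ∃ W, Tendsto (fun N => f N ω) atTop (𝓝 W) := by
  refine hf.exists_ae_tendsto_of_bdd (R := (μ.real Set.univ + B).toNNReal) fun N => ?_
  rw [eLpNorm_one_eq_lintegral_enorm,
    ← ofReal_integral_norm_eq_lintegral_enorm (hf.integrable N)]
  refine ENNReal.ofReal_le_ofReal ?_
  calc ∫ ω, ‖f N ω‖ ∂μ ≤ ∫ ω, (1 + f N ω ^ 2) ∂μ := by
        refine integral_mono (hf.integrable N).norm
          ((integrable_const 1).add (hL2 N).integrable_sq) fun ω => ?_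
        rw [Real.norm_eq_abs, ← sq_abs]
        nlinarith [sq_nonneg (|f N ω| - 1), abs_nonneg (f N ω)]
    _ = μ.real Set.univ + ∫ ω, f N ω ^ 2 ∂μ := by
        rw [integral_add (integrable_const 1) (hL2 N).integrable_sq]
        simp
    _ ≤ μ.real Set.univ + B := by gcongr; exact hB N

theorem ae_exists_tendsto_sum_range (hξ : ∀ t, StronglyMeasurable[ℱ (t + 1)] (ξ t))
    (hL2 : ∀ t, MemLp (ξ t) 2 μ) (hcond : ∀ t, μ[ξ t | ℱ t] =ᵐ[μ] 0) {B : ℝ}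
    (hB : ∀ N, ∑ t ∈ Finset.range N, ∫ ω, ξ t ω ^ 2 ∂μ ≤ B) :
    ∀ᵐ ω ∂μ, ∃ W, Tendsto (fun N => ∑ t ∈ Finset.range N, ξ t ω) atTop (𝓝 W) := by
  have hmart := martingale_sum_range hξ (fun t => (hL2 t).integrable one_le_two) hcond
  refine ae_exists_tendsto_of_integral_sq_le hmart.submartingale
    (fun N => memLp_finsetSum _ fun t _ => hL2 t) (B := B) fun N => ?_
  rw [integral_sq_sum_range hξ hL2 hcond]
  exact hB N

end MartingaleDifferences

section ConditionalLaw

variable {Ω E ι : Type*} {m mΩ : MeasurableSpace Ω} {mE : MeasurableSpace E}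

/-- Given the information in `m`, the random element `Y` has the conditional law `κ (Z ω)`, where
the discrete random variable `Z` belongs to that information. -/
structure HasCondLaw (μ : Measure Ω) (m : MeasurableSpace Ω) (κ : ι → Measure E) (Z : Ω → ι)
    (Y : Ω → E) : Prop where
  le : m ≤ mΩ
  measurableSet_eq : ∀ i, MeasurableSet[m] {ω | Z ω = i}
  measurable : Measurable[mΩ] Y
  condExp_indicator : ∀ B, MeasurableSet B → μ⟦Y ⁻¹' B | m⟧ =ᵐ[μ] fun ω => (κ (Z ω)).real B

namespace HasCondLaw

variable {μ : Measure Ω} [IsFiniteMeasure μ] {κ : ι → Measure E} [∀ i, IsFiniteMeasure (κ i)]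
  {Z : Ω → ι} {Y : Ω → E}

theorem map_restrict (h : HasCondLaw μ m κ Z Y) {i : ι} {A : Set Ω} (hA : MeasurableSet[m] A)
    (hAi : ∀ ω ∈ A, Z ω = i) : (μ.restrict A).map Y = μ A • κ i := by
  ext B hB
  have hYB : MeasurableSet (Y ⁻¹' B) := h.measurable hB
  have hreal : (μ.restrict A).real (Y ⁻¹' B) = μ.real A * (κ i).real B :=
    calc (μ.restrict A).real (Y ⁻¹' B)
        = ∫ ω in A, (Y ⁻¹' B).indicator (fun _ => (1 : ℝ)) ω ∂μ := by
          rw [integral_indicator_const _ hYB, smul_eq_mul, mul_one]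
      _ = ∫ ω in A, (μ⟦Y ⁻¹' B | m⟧) ω ∂μ :=
          (setIntegral_condExp h.le ((integrable_const 1).indicator hYB) hA).symm
      _ = ∫ _ in A, (κ i).real B ∂μ := by
          refine setIntegral_congr_ae (h.le A hA) ?_
          filter_upwards [h.condExp_indicator B hB] with ω hω hωA
          rw [hω, hAi ω hωA]
      _ = μ.real A * (κ i).real B := by rw [setIntegral_const, smul_eq_mul]
  rw [Measure.map_apply h.measurable hB, Measure.smul_apply, smul_eq_mul,
    ← ENNReal.toReal_eq_toReal_iff' (measure_ne_top _ _)
      (ENNReal.mul_ne_top (measure_ne_top _ _) (measure_ne_top _ _)), ENNReal.toReal_mul]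
  exact hreal

variable [Countable ι]

theorem ae_of_forall_ae (h : HasCondLaw μ m κ Z Y) {P : ι → E → Prop}
    (hP : ∀ i, ∀ᵐ y ∂(κ i), P i y) : ∀ᵐ ω ∂μ, P (Z ω) (Y ω) := by
  have hcell : ∀ i, ∀ᵐ ω ∂μ, Z ω = i → P i (Y ω) := fun i => by
    refine (ae_restrict_iff' (h.le _ (h.measurableSet_eq i))).1
      (ae_of_ae_map h.measurable.aemeasurable ?_)
    rw [h.map_restrict (h.measurableSet_eq i) fun _ hω => hω]
    exact Measure.ae_smul_measure (hP i) _
  filter_upwards [ae_all_iff.2 hcell] with ω hω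
  exact hω _ rfl

theorem condExp_eq_zero (h : HasCondLaw μ m κ Z Y) {f : ι → E → ℝ} (hf : ∀ i, Measurable (f i))
    (hint : Integrable (fun ω => f (Z ω) (Y ω)) μ) (hzero : ∀ i, ∫ y, f i y ∂(κ i) = 0) :
    μ[fun ω => f (Z ω) (Y ω) | m] =ᵐ[μ] 0 := by
  symm
  refine ae_eq_condExp_of_forall_setIntegral_eq h.le hint (fun _ _ _ => integrableOn_zero)
    (fun A hA _ => ?_) stronglyMeasurable_zero.aestronglyMeasurable
  let cell : ι → Set Ω := fun i => A ∩ {ω | Z ω = i}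
  have hcell_meas : ∀ i, MeasurableSet[m] (cell i) := fun i => hA.inter (h.measurableSet_eq i)
  have hcell_zero : ∀ i, ∫ ω in cell i, f (Z ω) (Y ω) ∂μ = 0 := fun i =>
    calc ∫ ω in cell i, f (Z ω) (Y ω) ∂μ = ∫ ω in cell i, f i (Y ω) ∂μ :=
          setIntegral_congr_fun (h.le _ (hcell_meas i)) fun ω hω => by
            simp only [show Z ω = i from hω.2]
      _ = ∫ y, f i y ∂((μ.restrict (cell i)).map Y) :=
          (integral_map h.measurable.aemeasurable (hf i).aestronglyMeasurable).symm
      _ = 0 := by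
          rw [h.map_restrict (hcell_meas i) fun _ hω => hω.2, integral_smul_measure, hzero,
            smul_zero]
  have hunion : A = ⋃ i, cell i := by ext ω; simp [cell]
  have hdisj : Pairwise (Function.onFun Disjoint cell) := fun i j hij =>
    Set.disjoint_left.2 fun ω hi hj => hij (hi.2.symm.trans hj.2)
  rw [hunion, integral_iUnion (fun i => h.le _ (hcell_meas i)) hdisj hint.integrableOn]
  simp [hcell_zero]

end HasCondLaw

theorem measurable_apply_of_countable [Countable ι] {f : ι → E → ℝ} (hf : ∀ i, Measurable (f i))
    {Z : Ω → ι} {Y : Ω → E} (hZ : ∀ i, MeasurableSet {ω | Z ω = i}) (hY : Measurable Y) :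
    Measurable fun ω => f (Z ω) (Y ω) := by
  let _ : MeasurableSpace ι := ⊤
  have hZ_meas : Measurable Z := measurable_to_countable' hZ
  exact (measurable_from_prod_countable_right (f := fun q : ι × E => f q.1 q.2) hf).comp
    (hZ_meas.prodMk hY)

end ConditionalLaw

section Indicator

variable {E : Type*} {mE : MeasurableSpace E} {μ : Measure E} [IsProbabilityMeasure μ] {A : Set E}

theorem abs_indicator_sub_measureReal_le_one (x : E) :
    |A.indicator (1 : E → ℝ) x - μ.real A| ≤ 1 := by
  classical
  have hnonneg : 0 ≤ μ.real A := measureReal_nonneg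
  have hle : μ.real A ≤ 1 := measureReal_le_one
  rw [Set.indicator_apply, Pi.one_apply, abs_le]
  split_ifs <;> constructor <;> linarith

theorem integral_indicator_sub_measureReal (hA : MeasurableSet A) :
    ∫ x, (A.indicator (1 : E → ℝ) x - μ.real A) ∂μ = 0 := by
  rw [integral_sub ((integrable_const 1).indicator hA) (integrable_const _),
    integral_indicator_one hA]
  simp

end Indicator

section Iterates

variable {S β : Type*} {F : (S → β) → S → β} {z : S}

/-- After `k` steps the iterates have settled at all points of height less than `k`. -/
theorem isFixedPt_iterate_of_height {h : S → ℕ} (hz : ∀ J, F J z = J z)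
    (hF : ∀ J J' i, i ≠ z → (∀ j, h j < h i → J j = J' j) → F J i = F J' i) {K : ℕ}
    (hK : ∀ i, h i < K) (J : S → β) : Function.IsFixedPt F (F^[K] J) := by
  have hsettled : ∀ k i, h i < k → F (F^[k] J) i = F^[k] J i := by
    intro k
    induction k with
    | zero => exact fun i hi => absurd hi (Nat.not_lt_zero _)
    | succ k ih =>
      intro i hi
      rw [Function.iterate_succ_apply']
      rcases eq_or_ne i z with rfl | hiz
      · exact hz _
      · exact hF _ _ i hiz fun j hj => ih j (by lia)
  exact funext fun i => hsettled K i (hK i)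

theorem iterate_apply_of_forall_apply_eq (hz : ∀ J, F J z = J z) (k : ℕ) (J : S → β) :
    F^[k] J z = J z := by
  induction k with
  | zero => rfl
  | succ k ih => rw [Function.iterate_succ_apply', hz, ih]

end Iterates

theorem sum_toReal_eq_one {α : Type*} [Fintype α] (q : PMF α) : ∑ a, (q a).toReal = 1 := by
  rw [← ENNReal.toReal_sum fun a _ => q.apply_ne_top a, ← tsum_fintype (L := .unconditional α),
    q.tsum_coe, ENNReal.toReal_one]

namespace FiniteMDP

section TrajectoryLaw

variable {S : Type u} [Fintype S] [MeasurableSpace S] [MeasurableSingletonClass S]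
  (M : FiniteMDP.{u, v} S) (p : PMF S) (m : M.Policy)

instance : IsProbabilityMeasure (M.trajLaw p m) := by
  unfold trajLaw
  infer_instance

theorem map_prodMk_trajLaw_eq_compProd (k : ℕ) :
    (M.trajLaw p m).map (fun x => (Preorder.frestrictLe (π := fun _ => S) k x, x (k + 1))) =
      (M.trajLaw p m).map (Preorder.frestrictLe (π := fun _ => S) k) ⊗ₘ
        M.historyKernel m k :=
  (Kernel.map_frestrictLe_trajMeasure_compProd_eq_map_trajMeasure (X := fun _ => S)
    (μ₀ := p.toMeasure) (κ := M.historyKernel m) (a := k)).symm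

theorem integral_trajLaw_succ (k : ℕ) (G : (Finset.Iic k → S) → S → ℝ) :
    ∫ x, G (Preorder.frestrictLe (π := fun _ => S) k x) (x (k + 1)) ∂(M.trajLaw p m) =
      ∫ x, ∑ j, (M.P (x k) (m (x k)) j).toReal *
        G (Preorder.frestrictLe (π := fun _ => S) k x) j ∂(M.trajLaw p m) := by
  let past : (ℕ → S) → Finset.Iic k → S := Preorder.frestrictLe (π := fun _ => S) k
  let now : Finset.Iic k := ⟨k, Finset.mem_Iic.2 le_rfl⟩
  have hpast : Measurable past := by fun_prop
  have hpair : Measurable fun x => (past x, x (k + 1)) := hpast.prodMk (measurable_pi_apply _)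
  have : IsProbabilityMeasure ((M.trajLaw p m).map past) :=
    Measure.isProbabilityMeasure_map hpast.aemeasurable
  calc ∫ x, G (past x) (x (k + 1)) ∂(M.trajLaw p m)
      = ∫ q, G q.1 q.2 ∂((M.trajLaw p m).map fun x => (past x, x (k + 1))) :=
        (integral_map (f := fun q : (Finset.Iic k → S) × S => G q.1 q.2) hpair.aemeasurable
          Measurable.of_discrete.aestronglyMeasurable).symm
    _ = ∫ y, ∫ j, G y j ∂(M.historyKernel m k y) ∂((M.trajLaw p m).map past) := by
        rw [map_prodMk_trajLaw_eq_compProd, Measure.integral_compProd Integrable.of_finite]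
    _ = ∫ y, ∑ j, (M.P (y now) (m (y now)) j).toReal * G y j ∂((M.trajLaw p m).map past) :=
        integral_congr_ae <| ae_of_all _ fun y =>
          PMF.integral_eq_sum (M.P (y now) (m (y now))) (G y)
    _ = _ := integral_map hpast.aemeasurable Measurable.of_discrete.aestronglyMeasurable

/-- A trajectory all of whose transitions have positive probability under the policy `m`. -/
def IsPath (x : ℕ → S) : Prop := ∀ k, 0 < M.P (x k) (m (x k)) (x (k + 1))

theorem ae_isPath : ∀ᵐ x ∂(M.trajLaw p m), M.IsPath m x := by
  refine ae_all_iff.2 fun k => ?_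
  let now : Finset.Iic k := ⟨k, Finset.mem_Iic.2 le_rfl⟩
  have hstep : ∀ y : Finset.Iic k → S,
      ∀ᵐ j ∂(M.historyKernel m k y), 0 < M.P (y now) (m (y now)) j := fun y => by
    change ∀ᵐ j ∂(M.P (y now) (m (y now))).toMeasure, _
    rw [← PMF.restrict_toMeasure_support]
    filter_upwards [ae_restrict_mem MeasurableSet.of_discrete] with j hj
    exact (PMF.apply_pos_iff _ j).2 hj
  have hpair := Measure.ae_compProd_of_ae_ae
    (p := fun q : (Finset.Iic k → S) × S => 0 < M.P (q.1 now) (m (q.1 now)) q.2)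
    MeasurableSet.of_discrete
    (ae_of_all ((M.trajLaw p m).map (Preorder.frestrictLe (π := fun _ => S) k)) hstep)
  rw [← map_prodMk_trajLaw_eq_compProd] at hpair
  exact ae_of_ae_map (f := fun x => (Preorder.frestrictLe (π := fun _ => S) k x, x (k + 1)))
    (by fun_prop) hpair

theorem map_apply_zero_trajLaw : (M.trajLaw p m).map (fun x => x 0) = p.toMeasure := by
  let toTuple : S ≃ᵐ (Finset.Iic 0 → S) := (MeasurableEquiv.piUnique fun _ => S).symm
  have htuple : (M.trajLaw p m).map (Preorder.frestrictLe (π := fun _ => S) 0) =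
      p.toMeasure.map toTuple := by
    unfold trajLaw Kernel.trajMeasure
    rw [Measure.map_comp _ _ (by fun_prop), Kernel.traj_map_frestrictLe, Kernel.partialTraj_self,
      Measure.id_comp]
  have hsymm : (fun x : ℕ → S => x 0) =
      toTuple.symm ∘ Preorder.frestrictLe (π := fun _ => S) 0 := rfl
  rw [hsymm, ← Measure.map_map (by fun_prop) (by fun_prop), htuple,
    MeasurableEquiv.map_symm_map]

theorem ae_trajLaw_pure_zero (i : S) : ∀ᵐ x ∂(M.trajLaw (PMF.pure i) m), x 0 = i := by
  refine ae_of_ae_map (f := fun x : ℕ → S => x 0) (p := (· = i))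
    (measurable_pi_apply 0).aemeasurable ?_
  rw [map_apply_zero_trajLaw, PMF.toMeasure_pure]
  exact (ae_dirac_iff MeasurableSet.of_discrete).2 rfl

end TrajectoryLaw

section Height

variable {S : Type u} {M : FiniteMDP.{u, v} S} {z : S}

/-- The height of a state `i`: the number of states that can be reached from `i`, in at least one
step, along edges out of states other than `z`. In an acyclic problem it decreases along
these edges. -/
noncomputable def height (M : FiniteMDP.{u, v} S) (z i : S) : ℕ :=
  {j | Relation.TransGen (fun a b => a ≠ z ∧ M.Edge a b) i j}.ncard

theorem edge_of_pos {i j : S} (a : M.Action i) (ha : 0 < M.P i a j) : M.Edge i j := by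
  classical
  exact ⟨Function.update (fun _ => Classical.arbitrary _) i a, by simpa using ha⟩

theorem height_le_card [Finite S] (i : S) : M.height z i ≤ Nat.card S := Set.ncard_le_card _

namespace IsAcyclicSSP

theorem not_transGen_self (hssp : M.IsAcyclicSSP z) (i : S) :
    ¬ Relation.TransGen (fun a b => a ≠ z ∧ M.Edge a b) i i := by
  have hlift : ∀ {a b : S}, Relation.TransGen (fun a b => a ≠ z ∧ M.Edge a b) a b →
      ∀ (ha : a ≠ z) (hb : b ≠ z),
        Relation.TransGen (fun s t : {s : S // s ≠ z} => M.Edge s t) ⟨a, ha⟩ ⟨b, hb⟩ := by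
    intro a b hab
    induction hab with
    | single hedge => exact fun _ _ => .single hedge.2
    | tail _ hedge ih => exact fun ha _ => .tail (ih ha hedge.1) hedge.2
  intro hcycle
  obtain ⟨j, hij, -⟩ := Relation.TransGen.head'_iff.1 hcycle
  exact hssp.acyclic ⟨i, hij.1⟩ (hlift hcycle hij.1 hij.1)

theorem height_lt [Finite S] (hssp : M.IsAcyclicSSP z) {i j : S} (hi : i ≠ z) (a : M.Action i)
    (hj : 0 < M.P i a j) : M.height z j < M.height z i := by
  have hij : i ≠ z ∧ M.Edge i j := ⟨hi, edge_of_pos a hj⟩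
  refine Set.ncard_lt_ncard ((Set.ssubset_iff_of_subset fun _ hk => ?_).2 ⟨j, ?_, ?_⟩)
    (Set.toFinite _)
  · exact Relation.TransGen.head hij hk
  · exact Relation.TransGen.single hij
  · exact hssp.not_transGen_self j

theorem prob_eq_zero_of_ne (hssp : M.IsAcyclicSSP z) (a : M.Action z) {j : S} (hj : j ≠ z) :
    M.P z a j = 0 := by
  rw [PMF.apply_eq_zero_iff, (PMF.apply_eq_one_iff _ _).1 (hssp.absorbing a)]
  exact hj

theorem succ_eq_of_isPath (hssp : M.IsAcyclicSSP z) {m : M.Policy} {x : ℕ → S}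
    (hx : M.IsPath m x) {k : ℕ} (hk : x k = z) : x (k + 1) = z := by
  subst hk
  by_contra hne
  exact (hx k).ne' (hssp.prob_eq_zero_of_ne _ hne)

theorem eq_of_isPath [Finite S] (hssp : M.IsAcyclicSSP z) {m : M.Policy} {x : ℕ → S}
    (hx : M.IsPath m x) {k : ℕ} (hk : Nat.card S < k) : x k = z := by
  have hdescend : ∀ k, x k = z ∨ M.height z (x k) + k ≤ M.height z (x 0) := by
    intro k
    induction k with
    | zero => exact .inr le_rfl
    | succ k ih =>
      by_cases hkz : x k = z
      · exact .inl (hssp.succ_eq_of_isPath hx hkz)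
      · have := ih.resolve_left hkz
        have := hssp.height_lt hkz _ (hx k)
        exact .inr (by lia)
  have := M.height_le_card (z := z) (x 0)
  exact (hdescend k).resolve_right (by lia)

end IsAcyclicSSP

end Height

section Bellman

variable {S : Type u} [Fintype S] {M : FiniteMDP.{u, v} S} {z : S}

theorem sum_toReal_mul_temporalDifference (V : S → ℝ) (i : S) (a : M.Action i) :
    ∑ j, (M.P i a j).toReal * (M.c i a + (V j - V i)) = M.backup V i a - V i := by
  simp only [mul_add, mul_sub, Finset.sum_add_distrib, Finset.sum_sub_distrib, ← Finset.sum_mul,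
    sum_toReal_eq_one, backup]
  ring

namespace IsAcyclicSSP

theorem backup_absorbing (hssp : M.IsAcyclicSSP z) (J : S → ℝ) (a : M.Action z) :
    M.backup J z a = J z := by
  unfold backup
  rw [hssp.cost_zero, Finset.sum_eq_single z]
  · simp [hssp.absorbing a]
  · intro j _ hj
    simp [hssp.prob_eq_zero_of_ne a hj]
  · simp

theorem backup_mono (hssp : M.IsAcyclicSSP z) {i : S} (hi : i ≠ z) (a : M.Action i)
    {J J' : S → ℝ} (hJ : ∀ j, M.height z j < M.height z i → J j ≤ J' j) :
    M.backup J i a ≤ M.backup J' i a := by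
  unfold backup
  gcongr M.c i a + ∑ j, ?_ with j
  rcases eq_or_ne (M.P i a j) 0 with hzero | hpos
  · simp [hzero]
  · exact mul_le_mul_of_nonneg_left (hJ j (hssp.height_lt hi a (pos_iff_ne_zero.2 hpos)))
      ENNReal.toReal_nonneg

theorem backup_congr (hssp : M.IsAcyclicSSP z) {i : S} (hi : i ≠ z) (a : M.Action i)
    {J J' : S → ℝ} (hJ : ∀ j, M.height z j < M.height z i → J j = J' j) :
    M.backup J i a = M.backup J' i a :=
  le_antisymm (hssp.backup_mono hi a fun j hj => (hJ j hj).le)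
    (hssp.backup_mono hi a fun j hj => (hJ j hj).ge)

theorem abs_backup_sub_le (hssp : M.IsAcyclicSSP z) {i : S} (hi : i ≠ z) (a : M.Action i)
    (J J' : S → ℝ) :
    |M.backup J i a - M.backup J' i a| ≤
      ∑ j with M.height z j < M.height z i, |J j - J' j| := by
  unfold backup
  rw [add_sub_add_left_eq_sub, ← Finset.sum_sub_distrib, Finset.sum_filter]
  refine (Finset.abs_sum_le_sum_abs _ _).trans (Finset.sum_le_sum fun j _ => ?_)
  rw [← mul_sub, abs_mul, abs_of_nonneg ENNReal.toReal_nonneg]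
  rcases eq_or_ne (M.P i a j) 0 with hzero | hpos
  · rw [hzero, ENNReal.toReal_zero, zero_mul]
    split_ifs <;> positivity
  · rw [if_pos (hssp.height_lt hi a (pos_iff_ne_zero.2 hpos))]
    exact mul_le_of_le_one_left (abs_nonneg _)
      (ENNReal.toReal_mono ENNReal.one_ne_top (PMF.coe_le_one _ _))

theorem exists_eq_backup (hssp : M.IsAcyclicSSP z) (m : M.Policy) :
    ∃ V : S → ℝ, V z = 0 ∧ ∀ i, V i = M.backup V i (m i) := by
  let F : (S → ℝ) → S → ℝ := fun J i => M.backup J i (m i)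
  have hz : ∀ J, F J z = J z := fun J => hssp.backup_absorbing J (m z)
  have hfix : Function.IsFixedPt F (F^[Nat.card S + 1] 0) :=
    isFixedPt_iterate_of_height hz (fun J J' i hi hJ => hssp.backup_congr hi (m i) hJ)
      (fun i => Nat.lt_succ_of_le (height_le_card i)) 0
  exact ⟨_, iterate_apply_of_forall_apply_eq hz _ 0, fun i => (congrFun hfix i).symm⟩

theorem exists_eq_iInf_backup (hssp : M.IsAcyclicSSP z) :
    ∃ V : S → ℝ, V z = 0 ∧ ∀ i, V i = ⨅ a, M.backup V i a := by
  let F : (S → ℝ) → S → ℝ := fun J i => ⨅ a, M.backup J i a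
  have hz : ∀ J, F J z = J z := fun J => by simp [F, hssp.backup_absorbing]
  have hfix : Function.IsFixedPt F (F^[Nat.card S + 1] 0) :=
    isFixedPt_iterate_of_height hz
      (fun J J' i hi hJ => iInf_congr fun a => hssp.backup_congr hi a hJ)
      (fun i => Nat.lt_succ_of_le (height_le_card i)) 0
  exact ⟨_, iterate_apply_of_forall_apply_eq hz _ 0, fun i => (congrFun hfix i).symm⟩

theorem le_of_le_backup_of_backup_le (hssp : M.IsAcyclicSSP z) {m : M.Policy} {V W : S → ℝ}
    (hz : V z ≤ W z) (hV : ∀ i, V i ≤ M.backup V i (m i))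
    (hW : ∀ i, M.backup W i (m i) ≤ W i) : V ≤ W := by
  intro i
  induction hn : M.height z i using Nat.strong_induction_on generalizing i with
  | _ n ih =>
    rcases eq_or_ne i z with rfl | hi
    · exact hz
    · exact (hV i).trans <|
        (hssp.backup_mono hi (m i) fun j hj => ih _ (hn ▸ hj) j rfl).trans (hW i)

end IsAcyclicSSP

end Bellman

section TemporalDifferences

variable {S : Type u}

theorem apply_hitTime {x : ℕ → S} {i : S} (hvisit : Visits x i) : x (hitTime x i) = i :=
  Nat.sInf_mem (s := {k | x k = i}) hvisit

theorem exists_le_and_eq_iff_hitTime_le {x : ℕ → S} {i : S} (hvisit : Visits x i) {k : ℕ} :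
    (∃ l ≤ k, x l = i) ↔ hitTime x i ≤ k :=
  ⟨fun ⟨_, hlk, hl⟩ => (Nat.sInf_le hl).trans hlk, fun hk => ⟨_, hk, apply_hitTime hvisit⟩⟩

variable {M : FiniteMDP.{u, v} S} {z : S} {m : M.Policy}

open Classical in
/-- The temporal difference of `V` along the transition of `x` at time `k`, counted only if `x` has
visited `i` by then. -/
noncomputable def tdError (m : M.Policy) (V : S → ℝ) (i : S) (k : ℕ) (x : ℕ → S) : ℝ :=
  if ∃ l ≤ k, x l = i then M.c (x k) (m (x k)) + (V (x (k + 1)) - V (x k)) else 0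

/-- The sum, up to time `K`, of the temporal differences of `V` along `x` from the first visit to
`i` onwards. It is the difference of the sampled cost from `i` and `V i`, written as a sum of
martingale differences. -/
noncomputable def tdSum (m : M.Policy) (V : S → ℝ) (i : S) (K : ℕ) (x : ℕ → S) : ℝ :=
  ∑ k ∈ Finset.range K, tdError m V i k x

theorem tdError_of_not_visits (V : S → ℝ) {i : S} {x : ℕ → S} (hvisit : ¬ Visits x i) (k : ℕ) :
    tdError m V i k x = 0 :=
  if_neg fun ⟨l, _, hl⟩ => hvisit ⟨l, hl⟩

theorem tdSum_of_not_visits (V : S → ℝ) {i : S} {x : ℕ → S} (hvisit : ¬ Visits x i) (K : ℕ) :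
    tdSum m V i K x = 0 :=
  Finset.sum_eq_zero fun k _ => tdError_of_not_visits V hvisit k

theorem tdSum_of_visits (V : S → ℝ) {i : S} {x : ℕ → S} (hvisit : Visits x i) {K : ℕ}
    (hK : hitTime x i ≤ K) :
    tdSum m V i K x =
      ∑ k ∈ Finset.Ico (hitTime x i) K, M.c (x k) (m (x k)) + (V (x K) - V i) := by
  have hfilter : (Finset.range K).filter (hitTime x i ≤ ·) = Finset.Ico (hitTime x i) K := by
    ext k
    simp [and_comm]
  simp only [tdSum, tdError, exists_le_and_eq_iff_hitTime_le hvisit]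
  rw [← Finset.sum_filter, hfilter, Finset.sum_add_distrib,
    Finset.sum_Ico_sub (fun k => V (x k)) hK, apply_hitTime hvisit]

namespace IsAcyclicSSP

theorem cost_eq_zero_of_isPath [Finite S] (hssp : M.IsAcyclicSSP z) {x : ℕ → S}
    (hx : M.IsPath m x) {k : ℕ} (hk : Nat.card S < k) : M.c (x k) (m (x k)) = 0 := by
  rw [hssp.eq_of_isPath hx hk]
  exact hssp.cost_zero _

theorem hitTime_le_of_isPath [Finite S] (hssp : M.IsAcyclicSSP z) {x : ℕ → S}
    (hx : M.IsPath m x) {i : S} (hvisit : Visits x i) {K : ℕ} (hK : Nat.card S < K) :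
    hitTime x i ≤ K := by
  by_contra! hlt
  have hiz : i = z := (apply_hitTime hvisit).symm.trans (hssp.eq_of_isPath hx (hK.trans hlt))
  exact hlt.not_ge (Nat.sInf_le ((hssp.eq_of_isPath hx hK).trans hiz.symm))

theorem tailCost_eq_sum_Ico [Finite S] (hssp : M.IsAcyclicSSP z) {x : ℕ → S}
    (hx : M.IsPath m x) (i : S) {K : ℕ} (hK : Nat.card S < K) :
    M.tailCost m x i = ∑ k ∈ Finset.Ico (hitTime x i) K, M.c (x k) (m (x k)) := by
  rw [Finset.sum_Ico_eq_sum_range]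
  refine tsum_eq_sum fun k hk => hssp.cost_eq_zero_of_isPath hx ?_
  have := Finset.mem_range.not.1 hk
  lia

theorem tdSum_eq_tailCost_sub [Finite S] (hssp : M.IsAcyclicSSP z) {x : ℕ → S}
    (hx : M.IsPath m x) {V : S → ℝ} (hV : V z = 0) {i : S} (hvisit : Visits x i) {K : ℕ}
    (hK : Nat.card S < K) : tdSum m V i K x = M.tailCost m x i - V i := by
  rw [tdSum_of_visits V hvisit (hssp.hitTime_le_of_isPath hx hvisit hK),
    hssp.tailCost_eq_sum_Ico hx i hK, hssp.eq_of_isPath hx hK, hV]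
  ring

open Classical in
theorem update_eq_add_tdSum [Finite S] (hssp : M.IsAcyclicSSP z) {x : ℕ → S}
    (hx : M.IsPath m x) {V : S → ℝ} (hV : V z = 0) {K : ℕ} (hK : Nat.card S < K)
    (γ J : S → ℝ) (i : S) :
    M.update γ m x J i =
      (1 - if Visits x i then γ i else 0) * J i + (if Visits x i then γ i else 0) * V i +
        γ i * tdSum m V i K x := by
  unfold update
  split_ifs with hvisit
  · rw [hssp.tdSum_eq_tailCost_sub hx hV hvisit hK]
    ring
  · rw [tdSum_of_not_visits V hvisit]
    ring

end IsAcyclicSSP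

theorem abs_tdError_le {V : S → ℝ} {C : ℝ} (hC : ∀ i j, |M.c i (m i) + (V j - V i)| ≤ C)
    (i : S) (k : ℕ) (x : ℕ → S) : |tdError m V i k x| ≤ C := by
  unfold tdError
  split_ifs
  · exact hC _ _
  · rw [abs_zero]
    exact (abs_nonneg _).trans (hC i i)

open Classical in
theorem abs_tdSum_le {V : S → ℝ} {C : ℝ} (hC : ∀ i j, |M.c i (m i) + (V j - V i)| ≤ C)
    (i : S) (K : ℕ) (x : ℕ → S) : |tdSum m V i K x| ≤ if Visits x i then K * C else 0 := by
  split_ifs with hvisit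
  · calc |tdSum m V i K x| ≤ ∑ k ∈ Finset.range K, |tdError m V i k x| :=
          Finset.abs_sum_le_sum_abs _ _
      _ ≤ ∑ _k ∈ Finset.range K, C := Finset.sum_le_sum fun k _ => abs_tdError_le hC i k x
      _ = K * C := by simp
  · rw [tdSum_of_not_visits V hvisit, abs_zero]

section Law

variable [MeasurableSpace S] [MeasurableSingletonClass S]

theorem measurable_tdError [Finite S] (m : M.Policy) (V : S → ℝ) (i : S) (k : ℕ) :
    Measurable (tdError m V i k) := by
  refine Measurable.ite ?_ ?_ measurable_const
  · simp only [Set.ofPred_exists, Set.ofPred_and]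
    measurability
  · have hpair : Measurable fun x : ℕ → S => (x k, x (k + 1)) := by fun_prop
    exact (Measurable.of_discrete
      (f := fun q : S × S => M.c q.1 (m q.1) + (V q.2 - V q.1))).comp hpair

theorem measurable_tdSum [Finite S] (m : M.Policy) (V : S → ℝ) (i : S) (K : ℕ) :
    Measurable (tdSum m V i K) :=
  Finset.measurable_fun_sum _ fun k _ => measurable_tdError m V i k

theorem integrable_tdError [Finite S] (m : M.Policy) (V : S → ℝ) (i : S) (k : ℕ)
    (μ : Measure (ℕ → S)) [IsFiniteMeasure μ] : Integrable (tdError m V i k) μ := by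
  obtain ⟨C, hC⟩ := (Set.finite_range fun q : S × S =>
    |M.c q.1 (m q.1) + (V q.2 - V q.1)|).bddAbove
  exact Integrable.of_bound (measurable_tdError m V i k).aestronglyMeasurable C
    (ae_of_all _ fun x => abs_tdError_le (fun i j => hC ⟨(i, j), rfl⟩) i k x)

theorem integrable_tdSum [Finite S] (m : M.Policy) (V : S → ℝ) (i : S) (K : ℕ)
    (μ : Measure (ℕ → S)) [IsFiniteMeasure μ] : Integrable (tdSum m V i K) μ :=
  integrable_finsetSum _ fun k _ => integrable_tdError m V i k μ

variable [Fintype S]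

theorem integral_tdError_eq_zero (p : PMF S) {V : S → ℝ}
    (hV : ∀ i, V i = M.backup V i (m i)) (i : S) (k : ℕ) :
    ∫ x, tdError m V i k x ∂(M.trajLaw p m) = 0 := by
  classical
  let now : Finset.Iic k := ⟨k, Finset.mem_Iic.2 le_rfl⟩
  let G : (Finset.Iic k → S) → S → ℝ := fun y j =>
    if ∃ l, y l = i then M.c (y now) (m (y now)) + (V j - V (y now)) else 0
  have hG : ∀ x, tdError m V i k x =
      G (Preorder.frestrictLe (π := fun _ => S) k x) (x (k + 1)) := fun x => by
    simp [tdError, G, now, Preorder.frestrictLe]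
  have hcentred : ∀ y : Finset.Iic k → S,
      ∑ j, (M.P (y now) (m (y now)) j).toReal * G y j = 0 := fun y => by
    by_cases hvisited : ∃ l, y l = i
    · simp only [G, if_pos hvisited, sum_toReal_mul_temporalDifference, ← hV, sub_self]
    · simp only [G, if_neg hvisited, mul_zero, Finset.sum_const_zero]
  simp_rw [hG]
  rw [integral_trajLaw_succ]
  exact integral_eq_zero_of_ae (ae_of_all _ fun x =>
    hcentred (Preorder.frestrictLe (π := fun _ => S) k x))

theorem integral_tdSum_eq_zero (p : PMF S) {V : S → ℝ}
    (hV : ∀ i, V i = M.backup V i (m i)) (i : S) (K : ℕ) :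
    ∫ x, tdSum m V i K x ∂(M.trajLaw p m) = 0 := by
  unfold tdSum
  rw [integral_finsetSum _ fun k _ => integrable_tdError m V i k _]
  exact Finset.sum_eq_zero fun k _ => integral_tdError_eq_zero p hV i k

end Law

end TemporalDifferences

section CostToGo

variable {S : Type u} [Fintype S] [MeasurableSpace S] [MeasurableSingletonClass S]
  {M : FiniteMDP.{u, v} S} {z : S}

namespace IsAcyclicSSP

theorem costToGo_eq_of_eq_backup (hssp : M.IsAcyclicSSP z) {m : M.Policy} {V : S → ℝ}
    (hVz : V z = 0) (hV : ∀ i, V i = M.backup V i (m i)) : M.costToGo m = V := by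
  ext i
  have hcost : ∀ᵐ x ∂(M.trajLaw (PMF.pure i) m),
      ∑' k, M.c (x k) (m (x k)) = tdSum m V i (Nat.card S + 1) x + V i := by
    filter_upwards [M.ae_isPath (PMF.pure i) m, M.ae_trajLaw_pure_zero m i] with x hx hstart
    have hhit : hitTime x i = 0 := Nat.le_zero.1 (Nat.sInf_le hstart)
    rw [hssp.tdSum_eq_tailCost_sub hx hVz ⟨0, hstart⟩ (Nat.lt_succ_self _), sub_add_cancel]
    exact tsum_congr fun k => by rw [hhit, zero_add]
  unfold costToGo
  rw [integral_congr_ae hcost, integral_add (integrable_tdSum m V i _ _) (integrable_const _),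
    integral_tdSum_eq_zero _ hV]
  simp

theorem costToGo_absorbing (hssp : M.IsAcyclicSSP z) (m : M.Policy) : M.costToGo m z = 0 := by
  obtain ⟨V, hVz, hV⟩ := hssp.exists_eq_backup m
  rw [hssp.costToGo_eq_of_eq_backup hVz hV, hVz]

theorem costToGo_eq_backup (hssp : M.IsAcyclicSSP z) (m : M.Policy) (i : S) :
    M.costToGo m i = M.backup (M.costToGo m) i (m i) := by
  obtain ⟨V, hVz, hV⟩ := hssp.exists_eq_backup m
  rw [hssp.costToGo_eq_of_eq_backup hVz hV]
  exact hV i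

theorem optimalCost_eq_of_eq_iInf_backup (hssp : M.IsAcyclicSSP z) {V : S → ℝ} (hVz : V z = 0)
    (hV : ∀ i, V i = ⨅ a, M.backup V i a) : M.optimalCost = V := by
  have hle : ∀ m : M.Policy, V ≤ M.costToGo m := fun m =>
    hssp.le_of_le_backup_of_backup_le (m := m) (hVz.trans (hssp.costToGo_absorbing m).symm).le
      (fun i => (hV i).trans_le (ciInf_le (Set.finite_range _).bddBelow (m i)))
      fun i => (hssp.costToGo_eq_backup m i).ge
  choose best hbest using fun i => exists_eq_ciInf_of_finite (f := fun a => M.backup V i a)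
  have hcost : M.costToGo best = V :=
    hssp.costToGo_eq_of_eq_backup hVz fun i => (hV i).trans (hbest i).symm
  ext i
  refine le_antisymm ?_ (le_ciInf fun m => hle m i)
  exact (ciInf_le (Set.finite_range _).bddBelow best).trans_eq (congrFun hcost i)

theorem optimalCost_absorbing (hssp : M.IsAcyclicSSP z) : M.optimalCost z = 0 := by
  simp [optimalCost, hssp.costToGo_absorbing]

theorem optimalCost_eq_iInf_backup (hssp : M.IsAcyclicSSP z) (i : S) :
    M.optimalCost i = ⨅ a, M.backup M.optimalCost i a := by
  obtain ⟨V, hVz, hV⟩ := hssp.exists_eq_iInf_backup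
  rw [hssp.optimalCost_eq_of_eq_iInf_backup hVz hV]
  exact hV i

theorem abs_costToGo_sub_optimalCost_le (hssp : M.IsAcyclicSSP z) {J : S → ℝ} {m : M.Policy}
    (hm : M.IsGreedy J m) (i : S) :
    |M.costToGo m i - M.optimalCost i| ≤
      ∑ j with M.height z j < M.height z i, |M.costToGo m j - M.optimalCost j| +
        2 * ∑ j with M.height z j < M.height z i, |J j - M.optimalCost j| := by
  rcases eq_or_ne i z with rfl | hi
  · rw [hssp.costToGo_absorbing, hssp.optimalCost_absorbing, sub_zero, abs_zero]
    positivity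
  obtain ⟨a, ha⟩ := exists_eq_ciInf_of_finite (f := fun a => M.backup M.optimalCost i a)
  rw [← hssp.optimalCost_eq_iInf_backup] at ha
  have hle : M.optimalCost i ≤ M.costToGo m i := ciInf_le (Set.finite_range _).bddBelow m
  have hcost := abs_le.1 (hssp.abs_backup_sub_le hi (m i) (M.costToGo m) M.optimalCost)
  have hJm := abs_le.1 (hssp.abs_backup_sub_le hi (m i) J M.optimalCost)
  have hJa := abs_le.1 (hssp.abs_backup_sub_le hi a J M.optimalCost)
  have hgreedy : M.backup J i (m i) ≤ M.backup J i a := hm i a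
  rw [abs_of_nonneg (sub_nonneg.2 hle), hssp.costToGo_eq_backup m i, ← ha]
  linarith [hcost.2, hJm.1, hJa.2]

end IsAcyclicSSP

end CostToGo

section VisitCount

variable {S : Type u}

open Classical in
theorem visitCount_succ (x : ℕ → ℕ → S) (t : ℕ) (i : S) :
    visitCount x (t + 1) i = visitCount x t i + if Visits (x t) i then 1 else 0 := by
  unfold visitCount
  rw [Finset.range_add_one, Finset.filter_insert]
  split_ifs
  · rw [Finset.card_insert_of_notMem (by simp)]
  · rw [add_zero]

open Classical in
theorem sum_visits_visitCount (x : ℕ → ℕ → S) (i : S) (g : ℕ → ℝ) (N : ℕ) :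
    ∑ t ∈ Finset.range N, (if Visits (x t) i then g (visitCount x t i) else 0) =
      ∑ k ∈ Finset.range (visitCount x N i), g k := by
  induction N with
  | zero => simp [visitCount]
  | succ N ih =>
    rw [Finset.sum_range_succ, ih, visitCount_succ]
    split_ifs
    · rw [Finset.sum_range_succ]
    · simp

open Classical in
theorem tendsto_visitCount_of_tendsto_sum_visits {x : ℕ → ℕ → S} {i : S} {b : ℕ → ℝ}
    (hb : BddAbove (Set.range b))
    (hsum : Tendsto (fun N => ∑ t ∈ Finset.range N, if Visits (x t) i then b t else 0)
      atTop atTop) :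
    Tendsto (fun N => visitCount x N i) atTop atTop := by
  obtain ⟨D, hD⟩ := hb
  have hbound : ∀ N, ∑ t ∈ Finset.range N, (if Visits (x t) i then b t else 0) ≤
      max D 1 * visitCount x N i := fun N =>
    calc ∑ t ∈ Finset.range N, (if Visits (x t) i then b t else 0)
        ≤ ∑ t ∈ Finset.range N, if Visits (x t) i then max D 1 else 0 := by
          refine Finset.sum_le_sum fun t _ => ?_
          split_ifs
          · exact (hD ⟨t, rfl⟩).trans (le_max_left D 1)
          · exact le_rfl
      _ = max D 1 * visitCount x N i := by
          rw [sum_visits_visitCount x i fun _ => max D 1, Finset.sum_const, Finset.card_range,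
            nsmul_eq_mul, mul_comm]
  refine (tendsto_natCast_atTop_iff (R := ℝ)).1 ?_
  exact (tendsto_atTop_mono hbound hsum).atTop_of_const_mul₀ (lt_max_of_lt_right one_pos)

variable [MeasurableSpace S] [MeasurableSingletonClass S]

theorem measurableSet_visits (i : S) : MeasurableSet {x : ℕ → S | Visits x i} := by
  simp only [Visits, Set.ofPred_exists]
  measurability

theorem measurable_visitCount {Ω : Type w} {mΩ : MeasurableSpace Ω} {ℱ : Filtration ℕ mΩ}
    {X : ℕ → Ω → ℕ → S} (hX : ∀ t, Measurable[ℱ (t + 1)] (X t)) (t : ℕ) (i : S) :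
    Measurable[ℱ t] fun ω => visitCount (fun s => X s ω) t i := by
  classical
  induction t with
  | zero =>
    simp only [visitCount, Finset.range_zero, Finset.filter_empty, Finset.card_empty]
    exact measurable_const
  | succ t ih =>
    simp only [visitCount_succ]
    exact (ih.mono (ℱ.mono t.le_succ) le_rfl).add
      (Measurable.ite (hX t (measurableSet_visits i)) measurable_const measurable_const)

end VisitCount

theorem exists_pos_le_measureReal_visits {S : Type u} [Fintype S] [MeasurableSpace S]
    [MeasurableSingletonClass S] {M : FiniteMDP.{u, v} S} {p : PMF S}
    (hreach : M.PositiveReachability p) (i : S) :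
    ∃ q > 0, ∀ m, q ≤ (M.trajLaw p m).real {x | Visits x i} := by
  obtain ⟨worst, hworst⟩ :=
    Finite.exists_min fun m : M.Policy => (M.trajLaw p m).real {x | Visits x i}
  exact ⟨_, ENNReal.toReal_pos (hreach worst i).ne' (measure_ne_top _ _), hworst⟩

section Run

variable {S : Type u} [Fintype S] [MeasurableSpace S] [MeasurableSingletonClass S]
  {M : FiniteMDP.{u, v} S} {p : PMF S} {Ω : Type w} {mΩ : MeasurableSpace Ω} {ℙ' : Measure Ω}
  {ℱ : Filtration ℕ mΩ} {γ : ℕ → Ω → S → ℝ} {J : ℕ → Ω → S → ℝ}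
  {pol : ℕ → Ω → M.Policy} {X : ℕ → Ω → ℕ → S}

namespace IsOPIRun

theorem hasCondLaw (hrun : M.IsOPIRun p ℙ' ℱ γ J pol X) (t : ℕ) :
    HasCondLaw ℙ' (ℱ t) (M.trajLaw p) (pol t) (X t) where
  le := ℱ.le t
  measurableSet_eq := hrun.pol_measurable t
  measurable := (hrun.traj_measurable t).mono (ℱ.le _) le_rfl
  condExp_indicator := hrun.traj_law t

theorem measurable_apply (hrun : M.IsOPIRun p ℙ' ℱ γ J pol X)
    {f : M.Policy → (ℕ → S) → ℝ} (hf : ∀ m, Measurable (f m)) (t : ℕ) :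
    Measurable[ℱ (t + 1)] fun ω => f (pol t ω) (X t ω) :=
  measurable_apply_of_countable hf (fun m => ℱ.mono t.le_succ _ (hrun.pol_measurable t m))
    (hrun.traj_measurable t)

variable [IsFiniteMeasure ℙ']

theorem ae_isPath (hrun : M.IsOPIRun p ℙ' ℱ γ J pol X) :
    ∀ᵐ ω ∂ℙ', ∀ t, M.IsPath (pol t ω) (X t ω) :=
  ae_all_iff.2 fun t => (hrun.hasCondLaw t).ae_of_forall_ae (M.ae_isPath p)

theorem ae_exists_tendsto_sum (hrun : M.IsOPIRun p ℙ' ℱ γ J pol X)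
    {f : M.Policy → (ℕ → S) → ℝ} (hf : ∀ m, Measurable (f m)) {C : ℝ}
    (hC : ∀ m x, |f m x| ≤ C) (hzero : ∀ m, ∫ x, f m x ∂(M.trajLaw p m) = 0)
    {g : ℕ → Ω → ℝ} (hg : ∀ t, StronglyMeasurable[ℱ t] (g t)) {B : ℝ}
    (hB : ∀ N ω, ∑ t ∈ Finset.range N, (g t ω * f (pol t ω) (X t ω)) ^ 2 ≤ B) :
    ∀ᵐ ω ∂ℙ', ∃ W, Tendsto (fun N => ∑ t ∈ Finset.range N, g t ω * f (pol t ω) (X t ω)) atTop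
      (𝓝 W) := by
  let ξ : ℕ → Ω → ℝ := fun t ω => g t ω * f (pol t ω) (X t ω)
  have hf_meas : ∀ t, StronglyMeasurable[ℱ (t + 1)] fun ω => f (pol t ω) (X t ω) := fun t =>
    (hrun.measurable_apply hf t).stronglyMeasurable
  have hf_int : ∀ t, Integrable (fun ω => f (pol t ω) (X t ω)) ℙ' := fun t =>
    Integrable.of_bound ((hf_meas t).mono (ℱ.le _)).aestronglyMeasurable C
      (ae_of_all _ fun ω => hC _ _)
  have hξ_meas : ∀ t, StronglyMeasurable[ℱ (t + 1)] (ξ t) := fun t =>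
    ((hg t).mono (ℱ.mono t.le_succ)).mul (hf_meas t)
  have hξ_sq : ∀ t ω, ξ t ω ^ 2 ≤ B := fun t ω =>
    (Finset.single_le_sum (f := fun t => ξ t ω ^ 2) (fun _ _ => sq_nonneg _)
      (Finset.self_mem_range_succ t)).trans (hB (t + 1) ω)
  have hξ_L2 : ∀ t, MemLp (ξ t) 2 ℙ' := fun t =>
    MemLp.of_bound ((hξ_meas t).mono (ℱ.le _)).aestronglyMeasurable (√B)
      (ae_of_all _ fun ω => Real.abs_le_sqrt (hξ_sq t ω))
  refine ae_exists_tendsto_sum_range hξ_meas hξ_L2 (fun t => ?_)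
    (B := ∫ _, B ∂ℙ') fun N => ?_
  · exact condExp_mul_eq_zero (hg t) ((hξ_L2 t).integrable one_le_two) (hf_int t)
      ((hrun.hasCondLaw t).condExp_eq_zero hf (hf_int t) hzero)
  · rw [← integral_finsetSum _ fun t _ => (hξ_L2 t).integrable_sq]
    exact integral_mono (integrable_finsetSum _ fun t _ => (hξ_L2 t).integrable_sq)
      (integrable_const B) (hB N)

open Classical in
theorem ae_tendsto_sum_visits (hrun : M.IsOPIRun p ℙ' ℱ γ J pol X)
    (hreach : M.PositiveReachability p) {b : ℕ → ℝ} (hb : ∀ t, 0 ≤ b t)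
    (hbsum : Tendsto (fun N => ∑ t ∈ Finset.range N, b t) atTop atTop)
    (hbsq : Summable fun t => b t ^ 2) (i : S) :
    ∀ᵐ ω ∂ℙ', Tendsto (fun N => ∑ t ∈ Finset.range N, if Visits (X t ω) i then b t else 0)
      atTop atTop := by
  obtain ⟨q, hq, hq_le⟩ := exists_pos_le_measureReal_visits hreach i
  let A : Set (ℕ → S) := {x | Visits x i}
  let f : M.Policy → (ℕ → S) → ℝ := fun m x => A.indicator 1 x - (M.trajLaw p m).real A
  have hf_le : ∀ m x, |f m x| ≤ 1 := fun m x => abs_indicator_sub_measureReal_le_one x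
  have hsq : ∀ N ω, ∑ t ∈ Finset.range N, (b t * f (pol t ω) (X t ω)) ^ 2 ≤ ∑' t, b t ^ 2 := by
    intro N ω
    refine (Finset.sum_le_sum fun t _ => ?_).trans
      (hbsq.sum_le_tsum (Finset.range N) fun _ _ => sq_nonneg _)
    rw [mul_pow]
    exact mul_le_of_le_one_right (sq_nonneg _) ((sq_le_one_iff_abs_le_one _).2 (hf_le _ _))
  filter_upwards [hrun.ae_exists_tendsto_sum (g := fun t _ => b t)
    (fun m => (measurable_one.indicator (measurableSet_visits i)).sub_const _) hf_le
    (fun m => integral_indicator_sub_measureReal (measurableSet_visits i))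
    (fun _ => stronglyMeasurable_const) hsq] with ω ⟨W, hW⟩
  refine tendsto_atTop_mono (fun N => ?_) ((hbsum.const_mul_atTop hq).atTop_add hW)
  rw [Finset.mul_sum, ← Finset.sum_add_distrib]
  refine Finset.sum_le_sum fun t _ => ?_
  calc q * b t + b t * f (pol t ω) (X t ω)
      ≤ (M.trajLaw p (pol t ω)).real A * b t + b t * f (pol t ω) (X t ω) := by
        gcongr
        · exact hb t
        · exact hq_le _
    _ = if Visits (X t ω) i then b t else 0 := by
        simp only [f, A, Set.indicator_apply, Set.mem_ofPred_eq, Pi.one_apply]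
        split_ifs <;> ring

end IsOPIRun

open Classical in
/-- The Robbins–Monro conditions on the step sizes of state `i`: they are chosen on the basis of
the past and, along the visits to `i`, they are square-summable (uniformly over the runs) but not
summable. -/
structure IsRobbinsMonro (ℙ' : Measure Ω) (ℱ : Filtration ℕ mΩ) (γ : ℕ → Ω → S → ℝ)
    (X : ℕ → Ω → ℕ → S) (i : S) : Prop where
  nonneg : ∀ t ω, 0 ≤ γ t ω i
  stronglyMeasurable : ∀ t, StronglyMeasurable[ℱ t] fun ω => γ t ω i
  exists_sum_sq_le : ∃ B, ∀ N ω,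
    ∑ t ∈ Finset.range N, (if Visits (X t ω) i then γ t ω i ^ 2 else 0) ≤ B
  ae_tendsto_sum : ∀ᵐ ω ∂ℙ', Tendsto
    (fun N => ∑ t ∈ Finset.range N, if Visits (X t ω) i then γ t ω i else 0) atTop atTop

namespace IsOPIRun

variable [IsFiniteMeasure ℙ']

theorem isRobbinsMonro_of_eq (hrun : M.IsOPIRun p ℙ' ℱ γ J pol X)
    (hreach : M.PositiveReachability p) {β : ℕ → ℝ} (hβ : ∀ t, 0 ≤ β t)
    (hβsum : Tendsto (fun N => ∑ t ∈ Finset.range N, β t) atTop atTop)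
    (hβsq : Summable fun t => β t ^ 2) {i : S} (hγ : ∀ t ω, γ t ω i = β t) :
    IsRobbinsMonro ℙ' ℱ γ X i where
  nonneg t ω := (hβ t).trans_eq (hγ t ω).symm
  stronglyMeasurable t := by
    simp only [hγ]
    exact stronglyMeasurable_const
  exists_sum_sq_le := by
    refine ⟨∑' t, β t ^ 2, fun N ω => (Finset.sum_le_sum fun t _ => ?_).trans
      (hβsq.sum_le_tsum (Finset.range N) fun _ _ => sq_nonneg _)⟩
    rw [hγ]
    split_ifs
    · exact le_rfl
    · exact sq_nonneg _
  ae_tendsto_sum := by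
    simp only [hγ]
    exact hrun.ae_tendsto_sum_visits hreach hβ hβsum hβsq i

theorem isRobbinsMonro_of_eq_visitCount (hrun : M.IsOPIRun p ℙ' ℱ γ J pol X)
    (hreach : M.PositiveReachability p) {β : ℕ → ℝ} (hβ : ∀ t, 0 ≤ β t)
    (hβsum : Tendsto (fun N => ∑ t ∈ Finset.range N, β t) atTop atTop)
    (hβsq : Summable fun t => β t ^ 2) {i : S}
    (hγ : ∀ t ω, γ t ω i = β (visitCount (fun s => X s ω) t i)) :
    IsRobbinsMonro ℙ' ℱ γ X i where
  nonneg t ω := (hβ _).trans_eq (hγ t ω).symm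
  stronglyMeasurable t := by
    simp only [hγ]
    exact ((Measurable.of_discrete (f := β)).comp
      (measurable_visitCount hrun.traj_measurable t i)).stronglyMeasurable
  exists_sum_sq_le := by
    refine ⟨∑' t, β t ^ 2, fun N ω => ?_⟩
    simp only [hγ]
    rw [sum_visits_visitCount (fun s => X s ω) i fun k => β k ^ 2]
    exact hβsq.sum_le_tsum _ fun _ _ => sq_nonneg _
  ae_tendsto_sum := by
    filter_upwards [hrun.ae_tendsto_sum_visits hreach hβ hβsum hβsq i] with ω hω
    simp only [hγ, sum_visits_visitCount (fun s => X s ω) i β]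
    exact hβsum.comp (tendsto_visitCount_of_tendsto_sum_visits
      (tendsto_zero_of_summable_sq hβsq).bddAbove_range hω)

end IsOPIRun

open Classical in
theorem exists_forall_abs_tdSum_costToGo_le (M : FiniteMDP.{u, v} S) (K : ℕ) :
    ∃ C : ℝ, 0 ≤ C ∧ ∀ (m : M.Policy) (i : S) (x : ℕ → S),
      |tdSum m (M.costToGo m) i K x| ≤ if Visits x i then C else 0 := by
  obtain ⟨C, hC⟩ := (Set.finite_range fun q : M.Policy × S × S =>
    |M.c q.2.1 (q.1 q.2.1) + (M.costToGo q.1 q.2.2 - M.costToGo q.1 q.2.1)|).bddAbove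
  have hC_max : ∀ (m : M.Policy) (i j : S),
      |M.c i (m i) + (M.costToGo m j - M.costToGo m i)| ≤ max C 0 := fun m i j =>
    (hC ⟨(m, i, j), rfl⟩).trans (le_max_left C 0)
  exact ⟨K * max C 0, by positivity, fun m i => abs_tdSum_le (hC_max m) i K⟩

namespace IsOPIRun

variable [IsFiniteMeasure ℙ'] {z : S}

theorem ae_exists_tendsto_sum_tdSum_costToGo (hssp : M.IsAcyclicSSP z)
    (hrun : M.IsOPIRun p ℙ' ℱ γ J pol X) {i : S} (hγ : IsRobbinsMonro ℙ' ℱ γ X i) (K : ℕ) :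
    ∀ᵐ ω ∂ℙ', ∃ W, Tendsto (fun N => ∑ t ∈ Finset.range N,
      γ t ω i * tdSum (pol t ω) (M.costToGo (pol t ω)) i K (X t ω)) atTop (𝓝 W) := by
  classical
  obtain ⟨C, hC, hbound⟩ := M.exists_forall_abs_tdSum_costToGo_le K
  obtain ⟨B, hB⟩ := hγ.exists_sum_sq_le
  refine hrun.ae_exists_tendsto_sum (f := fun m => tdSum m (M.costToGo m) i K) (C := C)
    (fun m => measurable_tdSum m _ i K) (fun m x => (hbound m i x).trans ?_)
    (fun m => integral_tdSum_eq_zero p (hssp.costToGo_eq_backup m) i K) hγ.stronglyMeasurable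
    (B := B * C ^ 2) fun N ω => ?_
  · split_ifs
    exacts [le_rfl, hC]
  · refine le_trans ?_ (mul_le_mul_of_nonneg_right (hB N ω) (sq_nonneg C))
    rw [Finset.sum_mul]
    refine Finset.sum_le_sum fun t _ => ?_
    rw [mul_pow]
    split_ifs with hvisit
    · have hle := hbound (pol t ω) i (X t ω)
      rw [if_pos hvisit] at hle
      exact mul_le_mul_of_nonneg_left (sq_le_sq.2 (hle.trans (le_abs_self C))) (sq_nonneg _)
    · rw [tdSum_of_not_visits _ hvisit]
      simp

theorem ae_tendsto_of_tendsto_costToGo (hssp : M.IsAcyclicSSP z)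
    (hrun : M.IsOPIRun p ℙ' ℱ γ J pol X) {i : S} (hγ : IsRobbinsMonro ℙ' ℱ γ X i) :
    ∀ᵐ ω ∂ℙ', ∀ l, Tendsto (fun t => M.costToGo (pol t ω) i) atTop (𝓝 l) →
      Tendsto (fun t => J t ω i) atTop (𝓝 l) := by
  classical
  obtain ⟨B, hB⟩ := hγ.exists_sum_sq_le
  filter_upwards [hrun.ae_isPath, hγ.ae_tendsto_sum,
    hrun.ae_exists_tendsto_sum_tdSum_costToGo hssp hγ (Nat.card S + 1)]
    with ω hpath hsum hnoise l hl
  let a : ℕ → ℝ := fun t => if Visits (X t ω) i then γ t ω i else 0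
  have ha : ∀ t, 0 ≤ a t := fun t => ite_nonneg (hγ.nonneg t ω) le_rfl
  have ha_sq : Summable fun t => a t ^ 2 :=
    summable_of_sum_range_le (c := B) (fun t => sq_nonneg _) fun N => by
      simpa only [a, ite_pow, zero_pow two_ne_zero] using hB N ω
  refine tendsto_of_stochastic_approximation ha (tendsto_zero_of_summable_sq ha_sq) hsum hnoise hl
    fun t => ?_
  rw [hrun.step, hssp.update_eq_add_tdSum (hpath t) (hssp.costToGo_absorbing _)
    (Nat.lt_succ_self _)]
  rfl

end IsOPIRun

theorem IsAcyclicSSP.tendsto_optimalCost_of_isGreedy {z : S} (hssp : M.IsAcyclicSSP z)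
    {ι : Type*} {l : Filter ι} {V : ι → S → ℝ} {m : ι → M.Policy}
    (hgreedy : ∀ t, M.IsGreedy (V t) (m t))
    (htrack : ∀ i c, Tendsto (fun t => M.costToGo (m t) i) l (𝓝 c) →
      Tendsto (fun t => V t i) l (𝓝 c)) :
    Tendsto V l (𝓝 M.optimalCost) := by
  have hcost : ∀ i, Tendsto (fun t => M.costToGo (m t) i) l (𝓝 (M.optimalCost i)) := by
    intro i
    induction hn : M.height z i using Nat.strong_induction_on generalizing i with
    | _ n ih =>
      subst hn
      have hlower : ∀ j ∈ Finset.univ.filter (fun j => M.height z j < M.height z i),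
          Tendsto (fun t => M.costToGo (m t) j) l (𝓝 (M.optimalCost j)) := fun j hj =>
        ih _ (Finset.mem_filter.1 hj).2 j rfl
      have hcost_sum := tendsto_finsetSum _ fun j hj =>
        tendsto_iff_norm_sub_tendsto_zero.1 (hlower j hj)
      have hV_sum := tendsto_finsetSum _ fun j hj =>
        tendsto_iff_norm_sub_tendsto_zero.1 (htrack j _ (hlower j hj))
      refine tendsto_iff_norm_sub_tendsto_zero.2 (squeeze_zero (fun t => norm_nonneg _)
        (fun t => hssp.abs_costToGo_sub_optimalCost_le (hgreedy t) i) ?_)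
      simpa using hcost_sum.add (hV_sum.const_mul 2)
  exact tendsto_pi_nhds.2 fun i => htrack i _ (hcost i)

end Run

end FiniteMDP

theorem mainTheorem2_general {S : Type u} [Fintype S] [MeasurableSpace S]
    [MeasurableSingletonClass S] (M : FiniteMDP.{u, v} S) {z : S} (p : PMF S)
    (hreach : M.PositiveReachability p) (hssp : M.IsAcyclicSSP z)
    (β : ℕ → ℝ) (hβ : ∀ t, 0 ≤ β t)
    (hβsum : Tendsto (fun N => ∑ t ∈ Finset.range N, β t) atTop atTop)
    (hβsq : Summable fun t => β t ^ 2)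
    {Ω : Type w} {mΩ : MeasurableSpace Ω} (ℙ' : Measure Ω) [IsFiniteMeasure ℙ']
    (ℱ : Filtration ℕ mΩ) (γ : ℕ → Ω → S → ℝ) (J : ℕ → Ω → S → ℝ)
    (pol : ℕ → Ω → M.Policy) (X : ℕ → Ω → ℕ → S) (hrun : M.IsOPIRun p ℙ' ℱ γ J pol X)
    (hγ : (∀ t ω i, γ t ω i = β t) ∨
      ∀ t ω i, γ t ω i = β (FiniteMDP.visitCount (fun s => X s ω) t i)) :
    ∀ᵐ ω ∂ℙ', Tendsto (fun t => J t ω) atTop (𝓝 M.optimalCost) := by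
  have hsteps : ∀ i, FiniteMDP.IsRobbinsMonro ℙ' ℱ γ X i := fun i =>
    hγ.elim (fun h => hrun.isRobbinsMonro_of_eq hreach hβ hβsum hβsq fun t ω => h t ω i)
      fun h => hrun.isRobbinsMonro_of_eq_visitCount hreach hβ hβsum hβsq fun t ω => h t ω i
  have htrack : ∀ᵐ ω ∂ℙ', ∀ i l, Tendsto (fun t => M.costToGo (pol t ω) i) atTop (𝓝 l) →
      Tendsto (fun t => J t ω i) atTop (𝓝 l) :=
    ae_all_iff.2 fun i => hrun.ae_tendsto_of_tendsto_costToGo hssp (hsteps i)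
  filter_upwards [htrack] with ω hω
  exact hssp.tendsto_optimalCost_of_isGreedy (fun t => hrun.greedy t ω) hω

theorem mainTheorem2 {n : ℕ} (M : FiniteMDP.{0, v} (Fin (n + 1))) (p : PMF (Fin (n + 1)))
    (hreach : M.PositiveReachability p)
    (hcommon : M.CommonTransitions)
    (hssp : M.IsAcyclicSSP 0)
    (β : ℕ → ℝ) (hβ : ∀ t, 0 ≤ β t)
    (hβsum : Tendsto (fun N => ∑ t ∈ Finset.range N, β t) atTop atTop)
    (hβsq : Summable fun t => β t ^ 2)
    {Ω : Type w} {mΩ : MeasurableSpace Ω} (ℙ' : Measure Ω) [IsProbabilityMeasure ℙ']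
    (ℱ : Filtration ℕ mΩ)
    (γ : ℕ → Ω → Fin (n + 1) → ℝ) (J : ℕ → Ω → Fin (n + 1) → ℝ)
    (pol : ℕ → Ω → M.Policy) (X : ℕ → Ω → ℕ → Fin (n + 1))
    (hrun : M.IsOPIRun p ℙ' ℱ γ J pol X)
    (hγ : (∀ t ω i, γ t ω i = β t) ∨
      ((∃ T, AntitoneOn β (Set.Ioi T)) ∧
        ∀ t ω i, γ t ω i = β (FiniteMDP.visitCount (fun s => X s ω) t i))) :
    ∀ᵐ ω ∂ℙ', Tendsto (fun t => J t ω) atTop (𝓝 M.optimalCost) :=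
  mainTheorem2_general M p hreach hssp β hβ hβsum hβsq ℙ' ℱ γ J pol X hrun (hγ.imp_right And.right)
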